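/- Let $\Gamma=(X,E)$ be a finite connected $k$-regular simple graph on $n=|X|$ vertices, with adjacency matrix $A$, diameter $D$, and distinct adjacency eigenvalues $\lambda_0>\lambda_1>\cdots>\lambda_d$ with multiplicities $m_0,\ldots,m_d$. Let $\Gamma_i(x)$ be the set of vertices at distance $i$ from $x$, and let $A_i$ be the distance-$i$ matrix, $(A_i)_{xy}=1$ if $\operatorname{dist}(x,y)=i$ and $0$ otherwise. The predistance polynomials $p_0,\ldots,p_d$ are the polynomials with $\deg p_i=i$ that are orthogonal for $\langle f,g\rangle=\frac1n\operatorname{tr}(f(A)g(A))$ and normalized by $\langle p_i,p_i\rangle=p_i(\lambda_0)$. Put $\phi_i=\prod_{j\ne i}(\lambda_i-\lambda_j)$ and $q_{d-1}=p_0+\cdots+p_{d-1}$. Then $\lambda_0=k$, and the following hold. (i) $$\frac1{|X|}\sum_{x\in X}\bigl(|X|-|\Gamma_D(x)|\bigr)\ \ge\ |X|-\sum_{i=D}^d p_i(k),$$ with equality if and only if $A_D=\sum_{i=D}^d p_i(A)$. (ii) If $A_D\in\operatorname{span}\{I,A,\ldots,A^d\}$, then $|\Gamma_D(x)|\le\sum_{i=D}^d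 p_i(k)$ for every $x\in X$. (iii) If equality holds in (i), then $A_D\in\operatorname{span}\{I,A,\ldots,A^d\}$. (iv) One has $$q_{d-1}(k)=n-p_d(k),\qquad p_d(k)=n\left(\sum_{i=0}^d\frac{\phi_0^2}{m_i\phi_i^2}\right)^{-1}.$$ The graph $\Gamma$ is distance-regular if and only if $D=d$ and $$\frac{|X|}{\sum_{x\in X}\frac1{|X|-|\Gamma_d(x)|}}=q_{d-1}(k)=|X|-p_d(k)=n\left[1-\left(\sum_{i=0}^d\frac{\phi_0^2}{m_i\phi_i^2}\right)^{-1}\right]$$ (for the one-vertex graph the left-hand side is read as $0$). Alternatively, $\Gamma$ is distance-regular if and only if $D=d$ and $$\frac1{|X|}\sum_{x\in X}\bigl(|X|-|\Gamma_D(x)|\bigr)=|X|-p_d(k)=n\left[1-\left(\sum_{i=0}^d\frac{\phi_0^2}{m_i\phi_i^2}\right)^{-1}\right],$$ or, in equivalent form, if and only if $D=d$ and $$\frac1{|X|}\sum_{x\in X}|\Gamma_D(x)|=p_d(k)=n\left(\sum_{i=0}^d\frac{\phi_0^2}{m_i\phi_i^2}\right)^{-1}.$$ -/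

import Mathlib

open Polynomial

noncomputable section

namespace GraphSpectrum

variable {V : Type*} [Fintype V] [DecidableEq V] (G : SimpleGraph V) [DecidableRel G.Adj]

/-- The set `Γ_i(x)` of the vertices at distance `i` from `x` (used for connected graphs). -/
def sphere (i : ℕ) (x : V) : Finset V :=
  Finset.univ.filter fun y => G.dist x y = i

/-- The distance-`i` matrix `A_i`: its `(x, y)` entry is `1` if `y` is at distance `i` from `x`,
and `0` otherwise. -/
def distMatrix (i : ℕ) : Matrix V V ℝ :=
  Matrix.of fun x y => if G.dist x y = i then 1 else 0

/-- The adjacency spectrum: the multiset of the eigenvalues of the (symmetric) adjacency matrix,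
repeated according to multiplicity. -/
def spec : Multiset ℝ := (G.adjMatrix ℝ).charpoly.roots

/-- The set `{λ_0, …, λ_d}` of the distinct eigenvalues. -/
def eigs : Finset ℝ := (spec G).toFinset

/-- The number `d`: one less than the number of distinct eigenvalues. -/
def dNum : ℕ := (eigs G).card - 1

/-- The largest eigenvalue `λ_0`. -/
def lambda0 : ℝ := sSup (eigs G : Set ℝ)

/-- The multiplicity `m(θ)` of the eigenvalue `θ`. -/
def mult (θ : ℝ) : ℕ := (spec G).count θ

/-- `φ(θ) = ∏ (θ - μ)` over the distinct eigenvalues `μ ≠ θ`; thus `φ_i = φ(λ_i)`. -/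
def phi (θ : ℝ) : ℝ := ∏ μ ∈ (eigs G).erase θ, (θ - μ)

/-- The sum `∑_{i=0}^d φ_0² / (m_i φ_i²)`, written as a sum over the distinct eigenvalues. -/
def phiSum : ℝ :=
  ∑ θ ∈ eigs G, phi G (lambda0 G) ^ 2 / ((mult G θ : ℝ) * phi G θ ^ 2)

/-- The scalar product `⟨f, g⟩ = (1/n) tr (f(A) g(A))`. -/
def scalar (f g : ℝ[X]) : ℝ :=
  (1 / (Fintype.card V : ℝ)) *
    (aeval (G.adjMatrix ℝ) f * aeval (G.adjMatrix ℝ) g).trace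

/-- The monic orthogonal polynomials of the scalar product: Gram–Schmidt applied to
`1, x, x², …` (meaningful for the indices `0, …, d`). -/
def orthoPoly : ℕ → ℝ[X]
  | i => X ^ i - ∑ j : Fin i,
      C (scalar G (X ^ i) (orthoPoly j) / scalar G (orthoPoly j) (orthoPoly j)) * orthoPoly j
decreasing_by exact j.isLt

/-- The predistance polynomials `p_0, …, p_d`: the multiples of the orthogonal polynomials
normalized by `‖p_i‖² = p_i(λ_0)`. -/
def predist (i : ℕ) : ℝ[X] :=
  C ((orthoPoly G i).eval (lambda0 G) / scalar G (orthoPoly G i) (orthoPoly G i)) * orthoPoly G i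

/-- Distance-regularity: `G` is connected and there are numbers `b_i`, `c_i` such that, whenever
`y` is at distance `i` from `x`, exactly `c_i` neighbours of `y` are at distance `i - 1` from `x`
and exactly `b_i` neighbours of `y` are at distance `i + 1` from `x`. -/
def IsDistanceRegular : Prop :=
  G.Connected ∧ ∃ b c : ℕ → ℕ, ∀ x y : V,
    (Finset.univ.filter fun z => G.Adj y z ∧ G.dist x z + 1 = G.dist x y).card
        = c (G.dist x y) ∧
    (Finset.univ.filter fun z => G.Adj y z ∧ G.dist x z = G.dist x y + 1).card
        = b (G.dist x y)

/-- The arithmetic mean of the numbers `|X| - |Γ_i(x)|`. -/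
def arithMean (i : ℕ) : ℝ :=
  (1 / (Fintype.card V : ℝ)) * ∑ x : V, ((Fintype.card V : ℝ) - ((sphere G i x).card : ℝ))

/-- The harmonic mean of the numbers `|X| - |Γ_i(x)|`. These are positive if `i ≥ 1`; for the
one-vertex graph and `i = 0` the value is `0`. -/
def harmMean (i : ℕ) : ℝ :=
  (Fintype.card V : ℝ) / ∑ x : V, 1 / ((Fintype.card V : ℝ) - ((sphere G i x).card : ℝ))

end GraphSpectrum

end

/-!
Let `r_0, r_1, …` be the monic orthogonal polynomials of `⟨f, g⟩ = (1/n) tr (f(A) g(A))`. By the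
spectral theorem this is `(1/n) ∑ m(θ) f(θ) g(θ)` over the distinct eigenvalues `θ`, and since `f(A)`
is symmetric it is also `(1/n) ∑ f(A)_{xy} g(A)_{xy}`; the proof compares the two descriptions.

*Spectral side.* The partial sum `q_{m-1} = p_0 + ⋯ + p_{m-1}` satisfies `⟨q_{m-1}, f⟩ = f(λ_0)`
whenever `deg f < m ≤ d + 1` (`scalar_predistSum`). Hence `q_d` vanishes at every eigenvalue other
than `λ_0 = k`, and connectivity forces `q_d(A) = J`, the all-ones matrix (`aeval_predistSum_apply`).
Consequences are `q_d(k) = n`, the simplicity of `k`, and `D ≤ d`. Pairing `r_d` with the monic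
polynomials `∏_{μ ≠ θ} (X - μ)` gives `r_d(θ) = n ‖r_d‖² / (m(θ) φ(θ))`, from which the formula for
`p_d(k)` follows (`predist_dNum_eval_lambda0`).

*The inequality.* At distance `D` the entries of `p_D(A) + ⋯ + p_d(A) = J - q_{D-1}(A)` are `1`,
because `q_{D-1}` has degree less than `D`. So the squared norm of the difference between `A_D` and
this matrix is `∑_{i ≥ D} p_i(k)` minus the mean of the `|Γ_D(x)|` (`norm_sq_distMatrix_sub`).

*Distance-regularity.* It is equivalent to `D = d` together with `A_d = p_d(A)`. If `Γ` is
distance-regular, then every `A_i` is a polynomial of degree at most `i` in `A`, which gives `D = d`,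
and `p_d(A) - A_d` is a polynomial of degree less than `d` in `A` that is orthogonal to itself
(`distMatrix_eq_of_isDistanceRegular`). Conversely `A_d = p_d(A)` propagates downwards to
`A_i = p_i(A)` for all `i` through the three-term recurrence (`distMatrix_eq_aeval_predist_step`), so
that the entries of every polynomial in `A` depend only on the distance. The condition on the
arithmetic mean is the case of equality above. For the harmonic mean, the Cauchy–Schwarz inequality
is applied to each column of `q_{d-1}(A)`, which is supported off `Γ_d(x)` and has sum
`q_{d-1}(k)`; equality on average forces each column to be constant on its support, and symmetry and
connectivity make the constant independent of the column (`distMatrix_eq_of_harmMean_eq`).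
-/

namespace GraphSpectrum

/-! ### The trace scalar product -/

section Scalar

variable {V : Type*} [Fintype V] [DecidableEq V] (G : SimpleGraph V) [DecidableRel G.Adj]

lemma transpose_aeval_adjMatrix (f : ℝ[X]) :
    (aeval (G.adjMatrix ℝ) f).transpose = aeval (G.adjMatrix ℝ) f := by
  induction f using Polynomial.induction_on' with
  | add p q hp hq => simp [hp, hq]
  | monomial i a => simp [aeval_monomial, ← Algebra.smul_def, Matrix.transpose_pow]

lemma aeval_adjMatrix_apply_comm (f : ℝ[X]) (x y : V) :
    aeval (G.adjMatrix ℝ) f x y = aeval (G.adjMatrix ℝ) f y x := by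
  conv_lhs => rw [← transpose_aeval_adjMatrix]
  rfl

lemma trace_aeval_adjMatrix (f : ℝ[X]) :
    (aeval (G.adjMatrix ℝ) f).trace = ((spec G).map fun θ => f.eval θ).sum := by
  have hA : (G.adjMatrix ℝ).IsHermitian := G.isHermitian_adjMatrix ℝ
  have hdiag : aeval (Matrix.diagonal hA.eigenvalues) f
      = Matrix.diagonal fun i => f.eval (hA.eigenvalues i) := by
    have h := aeval_algHom_apply (Matrix.diagonalAlgHom (n := V) (α := ℝ) ℝ) hA.eigenvalues f
    rw [Matrix.diagonalAlgHom_apply] at h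
    rw [h, Matrix.diagonalAlgHom_apply]
    congr 1
    ext i
    simp [coe_aeval_eq_eval]
  have hconj : aeval (G.adjMatrix ℝ) f = Unitary.conjStarAlgAut ℝ _ hA.eigenvectorUnitary
      (aeval (Matrix.diagonal hA.eigenvalues) f) := by
    conv_lhs => rw [hA.spectral_theorem]
    exact aeval_algHom_apply (Unitary.conjStarAlgAut ℝ _ hA.eigenvectorUnitary).toAlgEquiv.toAlgHom
      (Matrix.diagonal hA.eigenvalues) f
  rw [hconj, Unitary.conjStarAlgAut_apply, Matrix.trace_mul_comm, ← mul_assoc, hdiag, spec,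
    hA.roots_charpoly_eq_eigenvalues]
  simp [Matrix.trace]

lemma scalar_eq_sum_eigs (f g : ℝ[X]) :
    scalar G f g
      = (1 / (Fintype.card V : ℝ)) * ∑ θ ∈ eigs G, (mult G θ : ℝ) * (f.eval θ * g.eval θ) := by
  rw [scalar, ← map_mul, trace_aeval_adjMatrix, Finset.sum_multiset_map_count]
  simp [eigs, mult, nsmul_eq_mul]

lemma scalar_eq_sum_entries (f g : ℝ[X]) :
    scalar G f g = (1 / (Fintype.card V : ℝ)) *
      ∑ x, ∑ y, aeval (G.adjMatrix ℝ) f x y * aeval (G.adjMatrix ℝ) g x y := by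
  simp only [scalar, Matrix.trace, Matrix.diag, Matrix.mul_apply,
    aeval_adjMatrix_apply_comm G g]

/-- `scalar` as a bilinear form on polynomials. -/
noncomputable def scalarForm : ℝ[X] →ₗ[ℝ] ℝ[X] →ₗ[ℝ] ℝ :=
  LinearMap.mk₂ ℝ (scalar G)
    (fun f g h => by simp [scalar, add_mul, mul_add])
    (fun c f g => by simp [scalar]; ring)
    (fun f g h => by simp [scalar, mul_add])
    (fun c f g => by simp [scalar]; ring)

lemma scalarForm_apply (f g : ℝ[X]) : scalarForm G f g = scalar G f g := rfl

lemma scalar_comm (f g : ℝ[X]) : scalar G f g = scalar G g f := by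
  simp only [scalar_eq_sum_eigs, mul_comm (f.eval _)]

lemma scalar_X_mul (f g : ℝ[X]) : scalar G (X * f) g = scalar G f (X * g) := by
  simp only [scalar_eq_sum_eigs, eval_mul, eval_X]
  congr 1
  exact Finset.sum_congr rfl fun θ _ => by ring

lemma mult_pos {θ : ℝ} (hθ : θ ∈ eigs G) : 0 < (mult G θ : ℝ) := by
  have h := Multiset.count_pos.2 (Multiset.mem_toFinset.1 hθ)
  exact_mod_cast h

lemma phi_ne_zero (θ : ℝ) : phi G θ ≠ 0 :=
  Finset.prod_ne_zero_iff.2 fun _ hμ => sub_ne_zero.2 (Finset.ne_of_mem_erase hμ).symm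

variable [Nonempty V]

omit [DecidableEq V] in
lemma card_pos_real : 0 < (Fintype.card V : ℝ) := by exact_mod_cast Fintype.card_pos

lemma eval_eq_zero_of_scalar_self {f : ℝ[X]} (h : scalar G f f = 0) {θ : ℝ} (hθ : θ ∈ eigs G) :
    f.eval θ = 0 := by
  rw [scalar_eq_sum_eigs, mul_eq_zero] at h
  have h := h.resolve_left (one_div_pos.2 (card_pos_real (V := V))).ne'
  have h := (Finset.sum_eq_zero_iff_of_nonneg fun μ _ =>
    mul_nonneg (Nat.cast_nonneg _) (mul_self_nonneg _)).1 h θ hθ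
  simpa [(mult_pos G hθ).ne'] using h

lemma aeval_eq_zero_of_scalar_self {f : ℝ[X]} (h : scalar G f f = 0) :
    aeval (G.adjMatrix ℝ) f = 0 := by
  rw [scalar_eq_sum_entries, mul_eq_zero] at h
  have h := h.resolve_left (one_div_pos.2 (card_pos_real (V := V))).ne'
  have hrow := (Finset.sum_eq_zero_iff_of_nonneg fun x _ =>
    Finset.sum_nonneg fun y _ => mul_self_nonneg _).1 h
  ext x y
  have h := (Finset.sum_eq_zero_iff_of_nonneg fun y _ => mul_self_nonneg _).1
    (hrow x (Finset.mem_univ x)) y (Finset.mem_univ y)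
  simpa using h

lemma aeval_eq_zero_of_eval_eigs {f : ℝ[X]} (h : ∀ θ ∈ eigs G, f.eval θ = 0) :
    aeval (G.adjMatrix ℝ) f = 0 := by
  apply aeval_eq_zero_of_scalar_self
  rw [scalar_eq_sum_eigs, Finset.sum_eq_zero fun θ hθ => by rw [h θ hθ]; ring, mul_zero]

lemma eval_eq_zero_of_aeval {f : ℝ[X]} (h : aeval (G.adjMatrix ℝ) f = 0) {θ : ℝ}
    (hθ : θ ∈ eigs G) : f.eval θ = 0 :=
  eval_eq_zero_of_scalar_self G (by simp [scalar, h]) hθ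

lemma eigs_nonempty : (eigs G).Nonempty := by
  rw [Finset.nonempty_iff_ne_empty]
  intro h
  have h1 := scalar_eq_sum_eigs G 1 1
  rw [h, scalar_eq_sum_entries] at h1
  simp [Matrix.one_apply] at h1

lemma card_eigs : (eigs G).card = dNum G + 1 := by
  have := (eigs_nonempty G).card_pos
  rw [dNum]; omega

/-- The polynomial `∏ (X - μ)` over the eigenvalues `μ ≠ θ`, a multiple of the Lagrange
interpolation polynomial at `θ`. -/
noncomputable def nodalErase (θ : ℝ) : ℝ[X] := Lagrange.nodal ((eigs G).erase θ) id

omit [Nonempty V] in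
lemma eval_nodalErase_self (θ : ℝ) : (nodalErase G θ).eval θ = phi G θ := by
  simp [nodalErase, Lagrange.eval_nodal, phi]

omit [Nonempty V] in
lemma eval_nodalErase_of_ne {θ μ : ℝ} (hμ : μ ∈ eigs G) (h : μ ≠ θ) :
    (nodalErase G θ).eval μ = 0 :=
  Lagrange.eval_nodal_at_node (v := id) (Finset.mem_erase.2 ⟨h, hμ⟩)

omit [Nonempty V] in
lemma monic_nodalErase (θ : ℝ) : (nodalErase G θ).Monic := Lagrange.nodal_monic

lemma natDegree_nodalErase {θ : ℝ} (hθ : θ ∈ eigs G) : (nodalErase G θ).natDegree = dNum G := by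
  rw [nodalErase, Lagrange.natDegree_nodal, Finset.card_erase_of_mem hθ, card_eigs,
    Nat.add_sub_cancel]

omit [Nonempty V] in
lemma scalar_nodalErase (f : ℝ[X]) {θ : ℝ} (hθ : θ ∈ eigs G) :
    scalar G f (nodalErase G θ)
      = (1 / (Fintype.card V : ℝ)) * ((mult G θ : ℝ) * (f.eval θ * phi G θ)) := by
  rw [scalar_eq_sum_eigs, Finset.sum_eq_single_of_mem θ hθ, eval_nodalErase_self]
  intro μ hμ hμθ
  rw [eval_nodalErase_of_ne G hμ hμθ]
  ring

lemma eq_zero_of_eval_eigs {f : ℝ[X]} (hf : f.degree < (dNum G + 1 : ℕ))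
    (h : ∀ θ ∈ eigs G, f.eval θ = 0) : f = 0 :=
  eq_zero_of_degree_lt_of_eval_finset_eq_zero (eigs G) (by rwa [card_eigs]) h

end Scalar

/-! ### The orthogonal polynomials -/

section OrthoPoly

variable {V : Type*} [Fintype V] [DecidableEq V] (G : SimpleGraph V) [DecidableRel G.Adj]

lemma orthoPoly_eq (i : ℕ) : orthoPoly G i = X ^ i - ∑ j ∈ Finset.range i,
    C (scalar G (X ^ i) (orthoPoly G j) / scalar G (orthoPoly G j) (orthoPoly G j))
      * orthoPoly G j := by
  rw [orthoPoly, ← Fin.sum_univ_eq_sum_range (fun j => C (scalar G (X ^ i) (orthoPoly G j) /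
    scalar G (orthoPoly G j) (orthoPoly G j)) * orthoPoly G j)]

lemma monic_orthoPoly_and_degree (i : ℕ) :
    (orthoPoly G i).Monic ∧ (orthoPoly G i).degree = i := by
  induction i using Nat.strong_induction_on with
  | _ i ih =>
    rw [orthoPoly_eq]
    have hlt : (∑ j ∈ Finset.range i, C (scalar G (X ^ i) (orthoPoly G j) /
        scalar G (orthoPoly G j) (orthoPoly G j)) * orthoPoly G j).degree < (i : WithBot ℕ) := by
      rw [← mem_degreeLT]
      refine Submodule.sum_mem _ fun j hj => ?_
      rw [← smul_eq_C_mul]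
      refine Submodule.smul_mem _ _ ?_
      rw [mem_degreeLT, (ih j (Finset.mem_range.1 hj)).2]
      exact_mod_cast Finset.mem_range.1 hj
    exact ⟨monic_X_pow_sub hlt, by
      rw [degree_sub_eq_left_of_degree_lt (by simpa using hlt), degree_X_pow]⟩

lemma monic_orthoPoly (i : ℕ) : (orthoPoly G i).Monic := (monic_orthoPoly_and_degree G i).1

lemma degree_orthoPoly (i : ℕ) : (orthoPoly G i).degree = i := (monic_orthoPoly_and_degree G i).2

/-- A polynomial of degree less than `m + 1` is a multiple of the `m`-th orthogonal polynomial plus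
a polynomial of degree less than `m`. -/
lemma exists_eq_smul_orthoPoly_add {m : ℕ} {f : ℝ[X]} (hf : f.degree < (m + 1 : ℕ)) :
    ∃ g : ℝ[X], g.degree < (m : WithBot ℕ) ∧ f = f.coeff m • orthoPoly G m + g := by
  refine ⟨f - f.coeff m • orthoPoly G m, ?_, by abel⟩
  have hm : (orthoPoly G m).coeff m = 1 := by
    have := monic_orthoPoly G m
    rwa [Monic, leadingCoeff, natDegree_eq_of_degree_eq_some (degree_orthoPoly G m)] at this
  rw [degree_lt_iff_coeff_zero] at hf ⊢
  intro j hj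
  rcases hj.eq_or_lt with rfl | hj
  · simp [hm]
  · have h0 : (orthoPoly G m).coeff j = 0 :=
      coeff_eq_zero_of_degree_lt (by rw [degree_orthoPoly]; exact_mod_cast hj)
    simp [hf j hj, h0]

/-- A linear functional that kills `r_0, …, r_{m-1}` kills every polynomial of degree less
than `m`. -/
lemma linearMap_eq_zero_of_orthoPoly (φ : ℝ[X] →ₗ[ℝ] ℝ) {m : ℕ}
    (h : ∀ j < m, φ (orthoPoly G j) = 0) {f : ℝ[X]} (hf : f.degree < (m : WithBot ℕ)) :
    φ f = 0 := by
  induction m generalizing f with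
  | zero =>
    have : f = 0 := by
      rw [← degree_eq_bot]
      exact Nat.WithBot.lt_zero_iff.1 hf
    simp [this]
  | succ m ih =>
    obtain ⟨g, hg, hfg⟩ := exists_eq_smul_orthoPoly_add G hf
    rw [hfg, map_add, map_smul, h m m.lt_succ_self,
      ih (fun j hj => h j (hj.trans m.lt_succ_self)) hg]
    simp

variable [Nonempty V]

/-- If `⟨r_j, r_j⟩ = 0`, then `r_j(A) = 0`, so that orthogonality persists beyond the index `d`
despite the division by zero in the definition. -/
lemma scalar_orthoPoly_of_lt {i j : ℕ} (hij : j < i) :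
    scalar G (orthoPoly G i) (orthoPoly G j) = 0 := by
  induction i using Nat.strong_induction_on generalizing j with
  | _ i ih =>
    rw [orthoPoly_eq, ← scalarForm_apply, map_sub, LinearMap.sub_apply, map_sum,
      LinearMap.sum_apply, Finset.sum_eq_single j]
    · rw [← smul_eq_C_mul, map_smul, LinearMap.smul_apply, smul_eq_mul]
      simp only [scalarForm_apply]
      by_cases h : scalar G (orthoPoly G j) (orthoPoly G j) = 0
      · have h0 := aeval_eq_zero_of_scalar_self G h
        simp [scalar, h0]
      · field_simp
        simp
    · intro l hl hlj
      rw [← smul_eq_C_mul, map_smul, LinearMap.smul_apply, scalarForm_apply]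
      rcases lt_or_gt_of_ne hlj with h | h
      · rw [scalar_comm G (orthoPoly G l) (orthoPoly G j), ih j hij h, smul_zero]
      · rw [ih l (Finset.mem_range.1 hl) h, smul_zero]
    · intro h
      exact absurd (Finset.mem_range.2 hij) h

lemma scalar_orthoPoly_of_ne {i j : ℕ} (hij : i ≠ j) :
    scalar G (orthoPoly G i) (orthoPoly G j) = 0 := by
  rcases lt_or_gt_of_ne hij with h | h
  · rw [scalar_comm, scalar_orthoPoly_of_lt G h]
  · exact scalar_orthoPoly_of_lt G h

lemma scalar_orthoPoly_of_degree_lt {m : ℕ} {f : ℝ[X]} (hf : f.degree < (m : WithBot ℕ)) :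
    scalar G (orthoPoly G m) f = 0 :=
  linearMap_eq_zero_of_orthoPoly G (scalarForm G (orthoPoly G m))
    (fun _ hj => scalar_orthoPoly_of_lt G hj) hf

lemma scalar_orthoPoly_self_ne_zero {j : ℕ} (hj : j ≤ dNum G) :
    scalar G (orthoPoly G j) (orthoPoly G j) ≠ 0 := by
  intro h
  refine (monic_orthoPoly G j).ne_zero (eq_zero_of_eval_eigs G ?_ fun θ hθ =>
    eval_eq_zero_of_scalar_self G h hθ)
  rw [degree_orthoPoly]
  exact_mod_cast Nat.lt_succ_of_le hj

lemma scalar_orthoPoly_of_monic {m : ℕ} {f : ℝ[X]} (hf : f.Monic) (hdeg : f.natDegree = m) :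
    scalar G (orthoPoly G m) f = scalar G (orthoPoly G m) (orthoPoly G m) := by
  have hlt : f.degree < (m + 1 : ℕ) := by
    rw [degree_eq_natDegree hf.ne_zero, hdeg]
    exact_mod_cast m.lt_succ_self
  obtain ⟨g, hg, hfg⟩ := exists_eq_smul_orthoPoly_add G hlt
  have h1 : f.coeff m = 1 := by rw [← hdeg]; exact hf
  rw [hfg, h1, one_smul, ← scalarForm_apply, map_add]
  simp only [scalarForm_apply, scalar_orthoPoly_of_degree_lt G hg, add_zero]

/-- The expansion of `f(A)` in the matrices `r_0(A), …, r_d(A)`. -/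
lemma aeval_eq_sum_orthoPoly (f : ℝ[X]) :
    aeval (G.adjMatrix ℝ) f = ∑ j ∈ Finset.range (dNum G + 1),
      (scalar G f (orthoPoly G j) / scalar G (orthoPoly G j) (orthoPoly G j)) •
        aeval (G.adjMatrix ℝ) (orthoPoly G j) := by
  set h : ℝ[X] := f - ∑ j ∈ Finset.range (dNum G + 1),
    (scalar G f (orthoPoly G j) / scalar G (orthoPoly G j) (orthoPoly G j)) • orthoPoly G j with hh
  have horth : ∀ j < dNum G + 1, scalar G h (orthoPoly G j) = 0 := by
    intro j hj
    rw [← scalarForm_apply, hh, map_sub, LinearMap.sub_apply, map_sum, LinearMap.sum_apply,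
      Finset.sum_eq_single j]
    · rw [map_smul, LinearMap.smul_apply, smul_eq_mul]
      simp only [scalarForm_apply]
      rw [div_mul_cancel₀ _ (scalar_orthoPoly_self_ne_zero G (Nat.lt_succ_iff.1 hj)), sub_self]
    · intro l _ hlj
      rw [map_smul, LinearMap.smul_apply, scalarForm_apply, scalar_orthoPoly_of_ne G hlj, smul_zero]
    · intro hj'
      exact absurd (Finset.mem_range.2 hj) hj'
  have hzero : ∀ θ ∈ eigs G, h.eval θ = 0 := by
    intro θ hθ
    have h0 := linearMap_eq_zero_of_orthoPoly G (scalarForm G h) horth (f := nodalErase G θ) (by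
      rw [degree_eq_natDegree (monic_nodalErase G θ).ne_zero, natDegree_nodalErase G hθ]
      exact_mod_cast (dNum G).lt_succ_self)
    rw [scalarForm_apply, scalar_nodalErase G h hθ] at h0
    simpa [(mult_pos G hθ).ne', phi_ne_zero, Fintype.card_ne_zero] using h0
  have h0 := aeval_eq_zero_of_eval_eigs G hzero
  rw [hh, map_sub, map_sum, sub_eq_zero] at h0
  simpa using h0

end OrthoPoly

/-! ### Predistance polynomials and their partial sums -/

section Predistance

variable {V : Type*} [Fintype V] [DecidableEq V] (G : SimpleGraph V) [DecidableRel G.Adj]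

lemma predist_eq_smul (i : ℕ) : predist G i = ((orthoPoly G i).eval (lambda0 G) /
    scalar G (orthoPoly G i) (orthoPoly G i)) • orthoPoly G i := by
  rw [predist, smul_eq_C_mul]

lemma degree_predist_le (i : ℕ) : (predist G i).degree ≤ i := by
  rw [predist_eq_smul]
  exact (degree_smul_le _ _).trans (degree_orthoPoly G i).le

/-- The partial sum `q_{m-1} = p_0 + ⋯ + p_{m-1}` of the predistance polynomials. The index counts
the summands, so that the empty sum has index `0`. -/
noncomputable def predistSum (m : ℕ) : ℝ[X] := ∑ i ∈ Finset.range m, predist G i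

lemma predistSum_succ (m : ℕ) : predistSum G (m + 1) = predistSum G m + predist G m :=
  Finset.sum_range_succ _ _

lemma degree_predistSum_lt (m : ℕ) : (predistSum G m).degree < m := by
  rw [← mem_degreeLT]
  refine Submodule.sum_mem _ fun i hi => mem_degreeLT.2 ((degree_predist_le G i).trans_lt ?_)
  exact_mod_cast Finset.mem_range.1 hi

lemma eval_predistSum (m : ℕ) (t : ℝ) :
    (predistSum G m).eval t = ∑ i ∈ Finset.range m, (predist G i).eval t :=
  eval_finsetSum _ _ _

lemma sum_Icc_predist {D d : ℕ} (h : D ≤ d) :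
    ∑ i ∈ Finset.Icc D d, predist G i = predistSum G (d + 1) - predistSum G D := by
  rw [predistSum, predistSum, ← Finset.sum_Ico_eq_sub _ (by omega)]
  rfl

lemma scalar_add_left (f g h : ℝ[X]) : scalar G (f + g) h = scalar G f h + scalar G g h := by
  simp only [← scalarForm_apply, map_add, LinearMap.add_apply]

lemma scalar_sub_left (f g h : ℝ[X]) : scalar G (f - g) h = scalar G f h - scalar G g h := by
  simp only [← scalarForm_apply, map_sub, LinearMap.sub_apply]

lemma scalar_smul_left (c : ℝ) (f h : ℝ[X]) : scalar G (c • f) h = c * scalar G f h := by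
  simp only [← scalarForm_apply, map_smul, LinearMap.smul_apply, smul_eq_mul]

variable [Nonempty V]

/-- `q_{m-1}` represents the evaluation at `λ_0` on the polynomials of degree less than `m`. -/
lemma scalar_predistSum {m : ℕ} (hm : m ≤ dNum G + 1) {f : ℝ[X]} (hf : f.degree < m) :
    scalar G (predistSum G m) f = f.eval (lambda0 G) := by
  induction m generalizing f with
  | zero =>
    have : f = 0 := by
      rw [← degree_eq_bot]
      exact Nat.WithBot.lt_zero_iff.1 hf
    simp [this, scalar]
  | succ m ih =>
    obtain ⟨g, hg, hfg⟩ := exists_eq_smul_orthoPoly_add G hf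
    have hr : scalar G (predistSum G m) (orthoPoly G m) = 0 := by
      rw [scalar_comm, scalar_orthoPoly_of_degree_lt G (degree_predistSum_lt G m)]
    have hp : scalar G (predist G m) (orthoPoly G m) = (orthoPoly G m).eval (lambda0 G) := by
      rw [predist_eq_smul, scalar_smul_left,
        div_mul_cancel₀ _ (scalar_orthoPoly_self_ne_zero G (Nat.lt_succ_iff.1 hm))]
    have hpg : scalar G (predist G m) g = 0 := by
      rw [predist_eq_smul, scalar_smul_left, scalar_orthoPoly_of_degree_lt G hg, mul_zero]
    rw [hfg, predistSum_succ, scalar_add_left, scalar_comm, scalar_comm G (predist G m),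
      scalar_add_left, scalar_add_left, scalar_smul_left, scalar_smul_left,
      scalar_comm G _ (predistSum G m), scalar_comm G _ (predistSum G m),
      scalar_comm G _ (predist G m), scalar_comm G _ (predist G m), hr, hp, hpg,
      ih (by omega) hg, eval_add, eval_smul, smul_eq_mul]
    ring

lemma scalar_sum_Icc_predist_self {D : ℕ} (hD : D ≤ dNum G) :
    scalar G (∑ i ∈ Finset.Icc D (dNum G), predist G i) (∑ i ∈ Finset.Icc D (dNum G), predist G i)
      = ∑ i ∈ Finset.Icc D (dNum G), (predist G i).eval (lambda0 G) := by
  rw [← eval_finsetSum, sum_Icc_predist G hD, eval_sub]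
  set q := predistSum G (dNum G + 1) with hq
  set r := predistSum G D with hr
  have hrd : r.degree < D := degree_predistSum_lt G D
  have hqd : q.degree < (dNum G + 1 : ℕ) := degree_predistSum_lt G _
  have hqq : scalar G q q = q.eval (lambda0 G) := scalar_predistSum G le_rfl hqd
  have hqr : scalar G q r = r.eval (lambda0 G) := scalar_predistSum G le_rfl
    (hrd.trans (by exact_mod_cast Nat.lt_succ_of_le hD))
  have hrr : scalar G r r = r.eval (lambda0 G) := scalar_predistSum G (by omega) hrd
  rw [scalar_sub_left, scalar_comm G q, scalar_comm G r, scalar_sub_left, scalar_sub_left,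
    scalar_comm G r q, hqq, hqr, hrr]
  ring

lemma predistSum_eval_eq_zero {θ : ℝ} (hθ : θ ∈ eigs G) (h0 : lambda0 G ∈ eigs G)
    (h : θ ≠ lambda0 G) : (predistSum G (dNum G + 1)).eval θ = 0 := by
  have h1 := scalar_predistSum G le_rfl (f := nodalErase G θ) (by
    rw [degree_eq_natDegree (monic_nodalErase G θ).ne_zero, natDegree_nodalErase G hθ]
    exact_mod_cast (dNum G).lt_succ_self)
  rw [scalar_nodalErase G _ hθ, eval_nodalErase_of_ne G h0 h.symm] at h1
  simpa [(mult_pos G hθ).ne', phi_ne_zero, Fintype.card_ne_zero] using h1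

/-- `r_d` is orthogonal to every polynomial of degree less than `d`, so its product with each of
the monic polynomials `∏_{μ ≠ θ} (X - μ)` is `‖r_d‖²`. -/
lemma orthoPoly_dNum_eval {θ : ℝ} (hθ : θ ∈ eigs G) :
    (orthoPoly G (dNum G)).eval θ = (Fintype.card V : ℝ) *
      scalar G (orthoPoly G (dNum G)) (orthoPoly G (dNum G)) / ((mult G θ : ℝ) * phi G θ) := by
  have h := scalar_orthoPoly_of_monic G (monic_nodalErase G θ) (natDegree_nodalErase G hθ)
  have hm := (mult_pos G hθ).ne'
  have hφ := phi_ne_zero G θ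
  have hn := (card_pos_real (V := V)).ne'
  rw [← h, scalar_nodalErase G _ hθ]
  field_simp

lemma predist_dNum_eval_lambda0 (h0 : lambda0 G ∈ eigs G) (hm0 : mult G (lambda0 G) = 1) :
    (predist G (dNum G)).eval (lambda0 G) = (Fintype.card V : ℝ) * (phiSum G)⁻¹ := by
  set N := scalar G (orthoPoly G (dNum G)) (orthoPoly G (dNum G)) with hN
  set n : ℝ := (Fintype.card V : ℝ) with hn
  have hn0 : n ≠ 0 := (card_pos_real (V := V)).ne'
  have hN0 : N ≠ 0 := scalar_orthoPoly_self_ne_zero G le_rfl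
  have hφ0 := phi_ne_zero G (lambda0 G)
  have hNsum : N * phi G (lambda0 G) ^ 2 = n * N ^ 2 * phiSum G := by
    conv_lhs => rw [hN, scalar_eq_sum_eigs]
    rw [phiSum, Finset.mul_sum, Finset.mul_sum, Finset.sum_mul]
    refine Finset.sum_congr rfl fun θ hθ => ?_
    rw [orthoPoly_dNum_eval G hθ, ← hN, ← hn]
    have hm := (mult_pos G hθ).ne'
    have hφ := phi_ne_zero G θ
    field_simp
  have hS : phi G (lambda0 G) ^ 2 = n * N * phiSum G := by
    apply mul_left_cancel₀ hN0
    rw [hNsum]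
    ring
  have hS0 : phiSum G ≠ 0 := by
    intro h
    rw [h, mul_zero] at hS
    exact pow_ne_zero 2 hφ0 hS
  rw [predist_eq_smul, eval_smul, smul_eq_mul, ← hN, orthoPoly_dNum_eval G h0, ← hN, ← hn, hm0]
  field_simp
  rw [hS]
  push_cast
  ring

end Predistance

/-! ### Connected regular graphs and the Hoffman polynomial -/

section Regular

variable {V : Type*} [Fintype V] [DecidableEq V] (G : SimpleGraph V) [DecidableRel G.Adj]

lemma adjMatrix_pow_apply_eq_zero {i : ℕ} {x y : V} (h : i < G.dist x y) :
    (G.adjMatrix ℝ ^ i) x y = 0 := by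
  rw [SimpleGraph.adjMatrix_pow_apply_eq_card_walk, Nat.cast_eq_zero, Fintype.card_eq_zero_iff]
  refine ⟨fun p => ?_⟩
  have h1 := SimpleGraph.dist_le p.1
  have h2 : p.1.length = i := p.2
  omega

lemma aeval_adjMatrix_apply_eq_zero {f : ℝ[X]} {x y : V} (h : f.degree < G.dist x y) :
    aeval (G.adjMatrix ℝ) f x y = 0 := by
  rw [aeval_eq_sum_range, Matrix.sum_apply]
  refine Finset.sum_eq_zero fun i _ => ?_
  rw [Matrix.smul_apply]
  by_cases hi : i < G.dist x y
  · rw [adjMatrix_pow_apply_eq_zero G hi, smul_zero]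
  · rw [coeff_eq_zero_of_degree_lt (h.trans_le (by exact_mod_cast not_lt.1 hi)), zero_smul]

variable {G} {k : ℕ}

lemma aeval_adjMatrix_mulVec_one (hreg : G.IsRegularOfDegree k) (f : ℝ[X]) :
    (aeval (G.adjMatrix ℝ) f).mulVec (fun _ => 1) = fun _ => f.eval (k : ℝ) := by
  induction f using Polynomial.induction_on with
  | C a => ext x; simp [Matrix.algebraMap_eq_diagonal, Matrix.mulVec_diagonal]
  | add p q hp hq => ext x; simp [Matrix.add_mulVec, hp, hq]
  | monomial i a h =>
    have hA : (G.adjMatrix ℝ).mulVec (fun _ => (1 : ℝ)) = (k : ℝ) • fun _ => (1 : ℝ) := by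
      ext x
      have := SimpleGraph.adjMatrix_mulVec_const_apply_of_regular (a := (1 : ℝ)) hreg (v := x)
      simpa [Function.const_def] using this
    rw [pow_succ, ← mul_assoc, map_mul, aeval_X, ← Matrix.mulVec_mulVec, hA, Matrix.mulVec_smul, h]
    ext x
    simp
    ring

lemma sum_aeval_adjMatrix_apply (hreg : G.IsRegularOfDegree k) (f : ℝ[X]) (x : V) :
    ∑ y, aeval (G.adjMatrix ℝ) f x y = f.eval (k : ℝ) := by
  simpa [Matrix.mulVec, dotProduct] using congrFun (aeval_adjMatrix_mulVec_one hreg f) x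

lemma mem_eigs_iff {θ : ℝ} :
    θ ∈ eigs G ↔ Module.End.HasEigenvalue (Matrix.toLin' (G.adjMatrix ℝ)) θ := by
  rw [Module.End.hasEigenvalue_iff_isRoot_charpoly, eigs, spec, Multiset.mem_toFinset,
    mem_roots (Matrix.charpoly_monic _).ne_zero, Matrix.charpoly_toLin']

variable [Nonempty V]

lemma degree_mem_eigs (hreg : G.IsRegularOfDegree k) : (k : ℝ) ∈ eigs G := by
  rw [mem_eigs_iff]
  refine Module.End.hasEigenvalue_of_hasEigenvector (x := fun _ => 1) ⟨?_, ?_⟩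
  · rw [Module.End.mem_eigenspace_iff, Matrix.toLin'_apply]
    have := aeval_adjMatrix_mulVec_one hreg X
    rw [aeval_X] at this
    rw [this]
    ext x
    simp
  · intro h
    exact one_ne_zero (congrFun h (Classical.arbitrary V))

omit [Nonempty V] in
lemma le_degree_of_mem_eigs (hreg : G.IsRegularOfDegree k) {θ : ℝ} (hθ : θ ∈ eigs G) :
    θ ≤ k := by
  obtain ⟨x, hx⟩ := eigenvalue_mem_ball (mem_eigs_iff.1 hθ)
  have hsum : ∑ j ∈ Finset.univ.erase x, ‖G.adjMatrix ℝ x j‖ = k := by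
    rw [Finset.sum_erase _ (by simp)]
    have := sum_aeval_adjMatrix_apply hreg X x
    rw [aeval_X, eval_X] at this
    rw [← this]
    refine Finset.sum_congr rfl fun y _ => ?_
    rw [SimpleGraph.adjMatrix_apply]
    split_ifs <;> simp
  rw [hsum] at hx
  simpa using (le_abs_self θ).trans (by simpa using hx)

lemma lambda0_eq_degree (hreg : G.IsRegularOfDegree k) : lambda0 G = k :=
  IsGreatest.csSup_eq ⟨degree_mem_eigs hreg, fun _ hθ => le_degree_of_mem_eigs hreg hθ⟩

/-- The Hoffman polynomial: `q_d(A)` is the all-ones matrix. -/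
lemma aeval_predistSum_apply (hconn : G.Connected) (hreg : G.IsRegularOfDegree k) (x y : V) :
    aeval (G.adjMatrix ℝ) (predistSum G (dNum G + 1)) x y = 1 := by
  set H := predistSum G (dNum G + 1) with hH
  have hl := lambda0_eq_degree hreg
  have hk := degree_mem_eigs hreg
  have hann : aeval (G.adjMatrix ℝ) ((X - C (k : ℝ)) * H) = 0 := by
    refine aeval_eq_zero_of_eval_eigs G fun θ hθ => ?_
    by_cases h : θ = k
    · simp [h]
    · rw [eval_mul, hH, predistSum_eval_eq_zero G hθ (hl ▸ hk) (hl ▸ h), mul_zero]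
  -- The columns of `H(A)` lie in the kernel of the Laplacian, hence are constant.
  have hcol : ∀ x x' y : V, aeval (G.adjMatrix ℝ) H x y = aeval (G.adjMatrix ℝ) H x' y := by
    intro x x' y
    have hL : (G.lapMatrix ℝ).mulVec (fun z => aeval (G.adjMatrix ℝ) H z y) = 0 := by
      ext z
      rw [SimpleGraph.lapMatrix_mulVec_apply, hreg z]
      have := congrFun (congrFun hann z) y
      rw [map_mul, map_sub, aeval_X, aeval_C, sub_mul, Matrix.sub_apply,
        SimpleGraph.adjMatrix_mul_apply, ← Algebra.smul_def, Matrix.smul_apply] at this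
      simp only [Matrix.zero_apply, smul_eq_mul] at this
      simp only [Pi.zero_apply]
      linarith
    exact G.lapMatrix_mulVec_eq_zero_iff_forall_reachable.1 hL x x' (hconn.preconnected _ _)
  have hconst : ∀ z : V, aeval (G.adjMatrix ℝ) H z z = aeval (G.adjMatrix ℝ) H x y := fun z => by
    rw [hcol z x z, aeval_adjMatrix_apply_comm, hcol z y x, aeval_adjMatrix_apply_comm]
  have h1 : scalar G H 1 = 1 := by
    rw [hH, scalar_predistSum G le_rfl, eval_one]
    rw [degree_one]
    exact_mod_cast (dNum G).succ_pos
  rw [scalar, map_one, mul_one, Matrix.trace] at h1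
  simp only [Matrix.diag_apply, hconst, Finset.sum_const, Finset.card_univ, nsmul_eq_mul] at h1
  have hn := (card_pos_real (V := V)).ne'
  field_simp at h1
  exact h1

lemma predistSum_eval_degree (hconn : G.Connected) (hreg : G.IsRegularOfDegree k) :
    (predistSum G (dNum G + 1)).eval (k : ℝ) = Fintype.card V := by
  rw [← sum_aeval_adjMatrix_apply hreg _ (Classical.arbitrary V)]
  simp [aeval_predistSum_apply hconn hreg]

lemma mult_degree (hconn : G.Connected) (hreg : G.IsRegularOfDegree k) : mult G (k : ℝ) = 1 := by
  have hk := degree_mem_eigs hreg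
  have h1 := scalar_predistSum G le_rfl (f := nodalErase G (k : ℝ)) (by
    rw [degree_eq_natDegree (monic_nodalErase G _).ne_zero, natDegree_nodalErase G hk]
    exact_mod_cast (dNum G).lt_succ_self)
  rw [scalar_nodalErase G _ hk, lambda0_eq_degree hreg, eval_nodalErase_self,
    predistSum_eval_degree hconn hreg] at h1
  have hφ := phi_ne_zero G (k : ℝ)
  have hn := (card_pos_real (V := V)).ne'
  field_simp at h1
  exact_mod_cast h1

/-- The entries of `q_d(A)` are nonzero, while those at a distance larger than `d` of a polynomial
of degree `d` in `A` vanish. -/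
lemma dist_le_dNum (hconn : G.Connected) (hreg : G.IsRegularOfDegree k) (x y : V) :
    G.dist x y ≤ dNum G := by
  by_contra! h
  have h0 := aeval_adjMatrix_apply_eq_zero G (f := predistSum G (dNum G + 1)) (x := x) (y := y)
    ((degree_predistSum_lt G _).trans_le (by exact_mod_cast h))
  rw [aeval_predistSum_apply hconn hreg] at h0
  exact one_ne_zero h0

end Regular

/-! ### The mean number of vertices at a given distance -/

section Excess

variable {V : Type*} [Fintype V] [DecidableEq V] {G : SimpleGraph V} [DecidableRel G.Adj] {k : ℕ}

omit [DecidableEq V] [DecidableRel G.Adj] [Fintype V] in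
lemma distMatrix_apply (i : ℕ) (x y : V) :
    distMatrix G i x y = if G.dist x y = i then 1 else 0 := rfl

omit [DecidableEq V] [DecidableRel G.Adj] in
lemma sum_distMatrix_apply (i : ℕ) (x : V) : ∑ y, distMatrix G i x y = (sphere G i x).card := by
  simp [distMatrix_apply, sphere]

variable [Nonempty V]

omit [DecidableEq V] [DecidableRel G.Adj] in
lemma arithMean_eq (i : ℕ) : arithMean G i = (Fintype.card V : ℝ)
    - (1 / (Fintype.card V : ℝ)) * ∑ x, ((sphere G i x).card : ℝ) := by
  have hn := (card_pos_real (V := V)).ne'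
  rw [arithMean, Finset.sum_sub_distrib, Finset.sum_const, Finset.card_univ, nsmul_eq_mul]
  field_simp

lemma aeval_sum_Icc_predist_apply (hconn : G.Connected) (hreg : G.IsRegularOfDegree k) {D : ℕ}
    (hD : D ≤ dNum G) {x y : V} (hxy : G.dist x y = D) :
    aeval (G.adjMatrix ℝ) (∑ i ∈ Finset.Icc D (dNum G), predist G i) x y = 1 := by
  rw [sum_Icc_predist G hD, map_sub, Matrix.sub_apply, aeval_predistSum_apply hconn hreg,
    aeval_adjMatrix_apply_eq_zero G (hxy ▸ degree_predistSum_lt G D), sub_zero]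

/-- The squared distance between `A_D` and `p_D(A) + ⋯ + p_d(A)` in the normalized trace norm. -/
lemma norm_sq_distMatrix_sub (hconn : G.Connected) (hreg : G.IsRegularOfDegree k) {D : ℕ}
    (hD : D ≤ dNum G) :
    (1 / (Fintype.card V : ℝ)) * ∑ x, ∑ y, (distMatrix G D x y -
        aeval (G.adjMatrix ℝ) (∑ i ∈ Finset.Icc D (dNum G), predist G i) x y) ^ 2
      = ∑ i ∈ Finset.Icc D (dNum G), (predist G i).eval (k : ℝ)
        - (1 / (Fintype.card V : ℝ)) * ∑ x, ((sphere G D x).card : ℝ) := by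
  have hs := scalar_sum_Icc_predist_self G hD
  rw [lambda0_eq_degree hreg] at hs
  rw [← hs, scalar_eq_sum_entries, ← mul_sub, ← Finset.sum_sub_distrib]
  congr 1
  refine Finset.sum_congr rfl fun x _ => ?_
  rw [← sum_distMatrix_apply, ← Finset.sum_sub_distrib]
  refine Finset.sum_congr rfl fun y _ => ?_
  by_cases h : G.dist x y = D
  · rw [aeval_sum_Icc_predist_apply hconn hreg hD h, distMatrix_apply, if_pos h]
    norm_num
  · rw [distMatrix_apply, if_neg h]
    ring

lemma mean_card_sphere_le (hconn : G.Connected) (hreg : G.IsRegularOfDegree k) {D : ℕ}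
    (hD : D ≤ dNum G) : (1 / (Fintype.card V : ℝ)) * ∑ x, ((sphere G D x).card : ℝ)
      ≤ ∑ i ∈ Finset.Icc D (dNum G), (predist G i).eval (k : ℝ) := by
  rw [← sub_nonneg, ← norm_sq_distMatrix_sub hconn hreg hD]
  have := card_pos_real (V := V)
  positivity

lemma mean_card_sphere_eq_iff (hconn : G.Connected) (hreg : G.IsRegularOfDegree k) {D : ℕ}
    (hD : D ≤ dNum G) : (1 / (Fintype.card V : ℝ)) * ∑ x, ((sphere G D x).card : ℝ)
      = ∑ i ∈ Finset.Icc D (dNum G), (predist G i).eval (k : ℝ) ↔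
    distMatrix G D = ∑ i ∈ Finset.Icc D (dNum G), aeval (G.adjMatrix ℝ) (predist G i) := by
  rw [eq_comm, ← sub_eq_zero, ← norm_sq_distMatrix_sub hconn hreg hD, ← map_sum, mul_eq_zero,
    or_iff_right (one_div_pos.2 (card_pos_real (V := V))).ne']
  constructor
  · intro h
    ext x y
    have h := (Finset.sum_eq_zero_iff_of_nonneg fun x _ =>
      Finset.sum_nonneg fun y _ => sq_nonneg _).1 h x (Finset.mem_univ x)
    have h := (Finset.sum_eq_zero_iff_of_nonneg fun y _ => sq_nonneg _).1 h y (Finset.mem_univ y)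
    exact sub_eq_zero.1 (pow_eq_zero_iff two_ne_zero |>.1 h)
  · intro h
    rw [← h]
    simp

lemma card_sphere_le_of_aeval_eq (hconn : G.Connected) (hreg : G.IsRegularOfDegree k) {D : ℕ}
    (hD : D ≤ dNum G) {f : ℝ[X]} (hf : aeval (G.adjMatrix ℝ) f = distMatrix G D) (x : V) :
    ((sphere G D x).card : ℝ) ≤ ∑ i ∈ Finset.Icc D (dNum G), (predist G i).eval (k : ℝ) := by
  have hcard : ∀ z : V, ((sphere G D z).card : ℝ) = f.eval (k : ℝ) := fun z => by
    rw [← sum_distMatrix_apply, ← hf, sum_aeval_adjMatrix_apply hreg]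
  have h := mean_card_sphere_le hconn hreg hD
  have hn := (card_pos_real (V := V)).ne'
  simp only [hcard, Finset.sum_const, Finset.card_univ, nsmul_eq_mul] at h ⊢
  field_simp at h
  exact h

end Excess

/-! ### The harmonic mean -/

section Harmonic

variable {V : Type*} [Fintype V] [DecidableEq V] {G : SimpleGraph V} [DecidableRel G.Adj] {k : ℕ}
  [Nonempty V]

/-- For `d = 0` both sides are the all-ones matrix. -/
lemma distMatrix_eq_of_dNum_eq_zero (hconn : G.Connected) (hreg : G.IsRegularOfDegree k)
    (hd : dNum G = 0) : distMatrix G (dNum G) = aeval (G.adjMatrix ℝ) (predist G (dNum G)) := by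
  have h := aeval_predistSum_apply hconn hreg
  ext x y
  have hxy := dist_le_dNum hconn hreg x y
  have h1 := h x y
  rw [distMatrix_apply, if_pos (by omega), ← h1, predistSum_succ, hd]
  simp [predistSum]

omit [Fintype V] [DecidableEq V] [DecidableRel G.Adj] [Nonempty V] in
lemma eq_of_forall_adj (hconn : G.Connected) {α : Type*} {f : V → α}
    (h : ∀ x y, G.Adj x y → f x = f y) (x y : V) : f x = f y := by
  obtain ⟨p⟩ := hconn.preconnected x y
  induction p with
  | nil => rfl
  | cons hadj _ ih => exact (h _ _ hadj).trans ih

/-- Equality in the Cauchy–Schwarz inequality between the column `x` of `q_{d-1}(A)` and the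
indicator vector of its support, summed over `x`. -/
lemma predistSum_apply_of_harmMean_eq (hreg : G.IsRegularOfDegree k)
    (hd : dNum G ≠ 0) (hh : harmMean G (dNum G) = (predistSum G (dNum G)).eval (k : ℝ)) {x y : V}
    (hxy : G.dist x y ≠ dNum G) :
    aeval (G.adjMatrix ℝ) (predistSum G (dNum G)) x y = (predistSum G (dNum G)).eval (k : ℝ) /
      ((Fintype.card V : ℝ) - ((sphere G (dNum G) x).card : ℝ)) := by
  set d := dNum G with hdd
  set n : ℝ := (Fintype.card V : ℝ) with hn
  set Q := (predistSum G d).eval (k : ℝ) with hQ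
  set B := aeval (G.adjMatrix ℝ) (predistSum G d) with hB
  set s : V → ℝ := fun x => n - ((sphere G d x).card : ℝ) with hs
  have hn0 : 0 < n := card_pos_real (V := V)
  -- the number of vertices not at distance `d` from `x`, among them `x` itself
  have hscard : ∀ x, s x = ((Finset.univ.filter fun y => G.dist x y ≠ d).card : ℝ) := by
    intro x
    have h := Finset.card_filter_add_card_filter_not (s := (Finset.univ : Finset V))
      (fun y => G.dist x y = d)
    rw [Finset.card_univ] at h
    simp only [hs, hn, ← h, sphere]
    push_cast
    ring
  have hspos : ∀ x, 0 < s x := by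
    intro x
    rw [hscard, Nat.cast_pos, Finset.card_pos]
    exact ⟨x, by simpa using hd.symm⟩
  have hsum : ∑ x, 1 / s x ≠ 0 :=
    (Finset.sum_pos (fun x _ => one_div_pos.2 (hspos x)) Finset.univ_nonempty).ne'
  have hQT : n = Q * ∑ x, 1 / s x := by
    rw [← hh, harmMean]
    exact (div_mul_cancel₀ _ hsum).symm
  have hzero : ∀ x y, G.dist x y = d → B x y = 0 := fun x y h =>
    aeval_adjMatrix_apply_eq_zero G (h ▸ degree_predistSum_lt G d)
  have hrow : ∀ x, ∑ y ∈ Finset.univ.filter (fun y => G.dist x y ≠ d), B x y = Q := by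
    intro x
    rw [Finset.sum_filter_of_ne (p := fun y => G.dist x y ≠ d) fun y _ hy h => hy (hzero x y h)]
    exact sum_aeval_adjMatrix_apply hreg _ x
  have hsq : ∑ x, ∑ y ∈ Finset.univ.filter (fun y => G.dist x y ≠ d), B x y ^ 2 = n * Q := by
    have h := scalar_predistSum G (m := d) (by omega) (degree_predistSum_lt G d)
    rw [lambda0_eq_degree hreg, scalar_eq_sum_entries, ← hQ, ← hn, ← hB] at h
    rw [← h, ← mul_assoc, mul_one_div_cancel hn0.ne', one_mul]
    refine Finset.sum_congr rfl fun x _ => ?_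
    rw [Finset.sum_filter_of_ne (p := fun y => G.dist x y ≠ d) fun y _ hy h =>
      hy (by rw [hzero x y h]; ring)]
    exact Finset.sum_congr rfl fun y _ => sq _
  have hvar : ∑ x, ∑ y ∈ Finset.univ.filter (fun y => G.dist x y ≠ d), (B x y - Q / s x) ^ 2
      = 0 := by
    have hx : ∀ x, ∑ y ∈ Finset.univ.filter (fun y => G.dist x y ≠ d), (B x y - Q / s x) ^ 2
        = ∑ y ∈ Finset.univ.filter (fun y => G.dist x y ≠ d), B x y ^ 2 - Q * (Q * (1 / s x)) := by
      intro x
      have hsx := (hspos x).ne'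
      simp only [sub_sq, Finset.sum_add_distrib, Finset.sum_sub_distrib, ← Finset.sum_mul,
        ← Finset.mul_sum, hrow, Finset.sum_const, nsmul_eq_mul, ← hscard]
      field_simp
      ring
    simp only [hx, Finset.sum_sub_distrib, hsq, ← Finset.mul_sum]
    rw [← hQT]
    ring
  have h := (Finset.sum_eq_zero_iff_of_nonneg fun x _ =>
    Finset.sum_nonneg fun y _ => sq_nonneg _).1 hvar x (Finset.mem_univ x)
  have h := (Finset.sum_eq_zero_iff_of_nonneg fun y _ => sq_nonneg _).1 h y
    (Finset.mem_filter.2 ⟨Finset.mem_univ y, hxy⟩)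
  exact sub_eq_zero.1 (pow_eq_zero_iff two_ne_zero |>.1 h)

lemma distMatrix_eq_of_harmMean_eq (hconn : G.Connected) (hreg : G.IsRegularOfDegree k)
    (hh : harmMean G (dNum G) = (predistSum G (dNum G)).eval (k : ℝ)) :
    distMatrix G (dNum G) = aeval (G.adjMatrix ℝ) (predist G (dNum G)) := by
  rcases eq_or_ne (dNum G) 0 with hd | hd
  · exact distMatrix_eq_of_dNum_eq_zero hconn hreg hd
  have hB := fun x y => predistSum_apply_of_harmMean_eq hreg hd hh (x := x) (y := y)
  set B := aeval (G.adjMatrix ℝ) (predistSum G (dNum G)) with hBdef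
  set t : V → ℝ := fun x => (predistSum G (dNum G)).eval (k : ℝ) /
      ((Fintype.card V : ℝ) - ((sphere G (dNum G) x).card : ℝ)) with ht
  have hadj : ∀ x y, G.Adj x y → t x = t y := by
    intro x y hxy
    have h1 : G.dist x y = 1 := SimpleGraph.dist_eq_one_iff_adj.2 hxy
    by_cases hd1 : dNum G = 1
    · -- if `d = 1`, then the spheres in question have `k` elements
      have hcard : ∀ z, (sphere G (dNum G) z).card = k := by
        intro z
        rw [← hreg z, ← G.card_neighborFinset_eq_degree, hd1]
        congr 1
        ext w
        simp [sphere]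
      simp only [ht, hcard]
    · have hx := hB x y (by omega)
      have hy := hB y x (by rw [SimpleGraph.dist_comm]; omega)
      rw [hBdef, aeval_adjMatrix_apply_comm] at hx
      exact hx.symm.trans hy
  have hconst := eq_of_forall_adj hconn hadj
  -- the trace of `q_{d-1}(A)` is `n`, so the constant is `1`
  have ht1 : ∀ x, t x = 1 := by
    intro x
    have h1 : scalar G (predistSum G (dNum G)) 1 = 1 := by
      rw [scalar_predistSum G (Nat.le_succ _), eval_one]
      rw [degree_one]
      exact_mod_cast Nat.pos_of_ne_zero hd
    have hdiag : ∀ z, B z z = t x := fun z => by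
      rw [hB z z (by simpa using hd.symm)]
      exact hconst z x
    rw [scalar, map_one, mul_one, Matrix.trace] at h1
    simp only [Matrix.diag_apply, ← hBdef, hdiag, Finset.sum_const, Finset.card_univ,
      nsmul_eq_mul] at h1
    have hn := (card_pos_real (V := V)).ne'
    field_simp at h1
    exact h1
  ext x y
  have h := aeval_predistSum_apply hconn hreg x y
  rw [predistSum_succ, map_add, Matrix.add_apply, ← hBdef] at h
  rw [distMatrix_apply]
  split_ifs with hxy
  · have h0 : B x y = 0 := aeval_adjMatrix_apply_eq_zero G (hxy ▸ degree_predistSum_lt G _)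
    linarith
  · have h1 : B x y = 1 := (hB x y hxy).trans (ht1 x)
    linarith

end Harmonic

/-! ### Vertices at prescribed distances -/

section Distance

variable {V : Type*} {G : SimpleGraph V}

lemma exists_adj_dist_eq (hconn : G.Connected) {x z : V} {m : ℕ} (h : G.dist x z = m + 1) :
    ∃ y, G.Adj z y ∧ G.dist x y = m := by
  obtain ⟨p, hp⟩ := hconn.exists_walk_length_eq_dist z x
  rw [SimpleGraph.dist_comm, h] at hp
  cases p with
  | nil => simp at hp
  | @cons _ y _ hadj q =>
    refine ⟨y, hadj, le_antisymm ?_ ?_⟩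
    · rw [SimpleGraph.dist_comm]
      have := SimpleGraph.dist_le q
      rw [SimpleGraph.Walk.length_cons] at hp
      omega
    · have h1 := hconn.dist_triangle (u := x) (v := y) (w := z)
      rw [SimpleGraph.dist_eq_one_iff_adj.2 hadj.symm, h] at h1
      omega

lemma exists_dist_eq (hconn : G.Connected) {x z : V} {j : ℕ} (hj : j ≤ G.dist x z) :
    ∃ y, G.dist x y = j := by
  obtain ⟨m, hm⟩ := Nat.exists_eq_add_of_le hj
  induction m generalizing z with
  | zero => exact ⟨z, hm⟩
  | succ m ih =>
    obtain ⟨y, -, hy⟩ := exists_adj_dist_eq hconn (x := x) (z := z) (m := j + m) (by omega)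
    exact ih (by omega) hy

lemma exists_forall_eq_of_dist {F : V → V → ℕ}
    (hF : ∀ x y x' y', G.dist x y = G.dist x' y' → F x y = F x' y') :
    ∃ c : ℕ → ℕ, ∀ x y, F x y = c (G.dist x y) := by
  classical
  refine ⟨fun m => if h : ∃ p : V × V, G.dist p.1 p.2 = m then F h.choose.1 h.choose.2 else 0,
    fun x y => ?_⟩
  have h : ∃ p : V × V, G.dist p.1 p.2 = G.dist x y := ⟨(x, y), rfl⟩
  simp only [dif_pos h]
  exact hF _ _ _ _ h.choose_spec.symm

end Distance

/-! ### Distance-regularity from the last distance matrix -/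

section FromExcess

variable {V : Type*} [Fintype V] [DecidableEq V] {G : SimpleGraph V} [DecidableRel G.Adj] {k : ℕ}
  [Nonempty V]

omit [Nonempty V] in
/-- Off distance `l`, the entries of `r_l(A)` vanish as soon as `A_l = p_l(A)` is nonzero. -/
lemma smul_aeval_orthoPoly_of_distMatrix_eq {l : ℕ} {u v : V} (huv : G.dist u v = l)
    (hl : distMatrix G l = aeval (G.adjMatrix ℝ) (predist G l)) :
    ∃ a : ℝ, aeval (G.adjMatrix ℝ) (orthoPoly G l) = a • distMatrix G l := by
  rw [predist_eq_smul, map_smul] at hl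
  set c := (orthoPoly G l).eval (lambda0 G) / scalar G (orthoPoly G l) (orthoPoly G l)
  have hc : c ≠ 0 := by
    intro hc
    have h := congrFun (congrFun hl u) v
    rw [hc, zero_smul, distMatrix_apply, if_pos huv] at h
    exact one_ne_zero h
  exact ⟨c⁻¹, by rw [hl, smul_smul, inv_mul_cancel₀ hc, one_smul]⟩

/-- Downward step: `A A_{j+1}` has no entries at distances smaller than `j`, and the coefficient of
`r_j(A)` in its expansion is the only nonzero one among those of `r_0(A), …, r_j(A)`. -/
lemma distMatrix_eq_aeval_predist_step (hconn : G.Connected) (hreg : G.IsRegularOfDegree k) {j : ℕ}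
    (hj : j + 1 ≤ dNum G) (hex : ∀ l ≤ dNum G, ∃ u v : V, G.dist u v = l)
    (ih : ∀ l, j < l → l ≤ dNum G →
      distMatrix G l = aeval (G.adjMatrix ℝ) (predist G l)) :
    distMatrix G j = aeval (G.adjMatrix ℝ) (predist G j) := by
  have hr : ∀ l, j < l → l ≤ dNum G → ∃ a : ℝ,
      aeval (G.adjMatrix ℝ) (orthoPoly G l) = a • distMatrix G l := fun l hjl hl => by
    obtain ⟨u, v, huv⟩ := hex l hl
    exact smul_aeval_orthoPoly_of_distMatrix_eq huv (ih l hjl hl)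
  have hr0 : ∀ l, j < l → l ≤ dNum G → ∀ x y : V, G.dist x y ≠ l →
      aeval (G.adjMatrix ℝ) (orthoPoly G l) x y = 0 := fun l hjl hl x y hxy => by
    obtain ⟨a, ha⟩ := hr l hjl hl
    rw [ha, Matrix.smul_apply, distMatrix_apply, if_neg hxy, smul_zero]
  have hcoef : scalar G (X * orthoPoly G (j + 1)) (orthoPoly G j) ≠ 0 := by
    rw [scalar_X_mul, scalar_orthoPoly_of_monic G (monic_X.mul (monic_orthoPoly G j))]
    · exact scalar_orthoPoly_self_ne_zero G hj
    · rw [monic_X.natDegree_mul (monic_orthoPoly G j), natDegree_X,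
        natDegree_eq_of_degree_eq_some (degree_orthoPoly G j), add_comm]
  have hcoef0 : ∀ l < j, scalar G (X * orthoPoly G (j + 1)) (orthoPoly G l) = 0 := by
    intro l hl
    rw [scalar_X_mul, scalar_orthoPoly_of_degree_lt]
    rw [degree_mul, degree_X, degree_orthoPoly]
    exact_mod_cast (by omega : 1 + l < j + 1)
  have hrj : ∀ x y : V, G.dist x y < j → aeval (G.adjMatrix ℝ) (orthoPoly G j) x y = 0 := by
    intro x y hxy
    have hexp := congrFun (congrFun (aeval_eq_sum_orthoPoly G (X * orthoPoly G (j + 1))) x) y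
    rw [Matrix.sum_apply, Finset.sum_eq_single j] at hexp
    · have hleft : aeval (G.adjMatrix ℝ) (X * orthoPoly G (j + 1)) x y = 0 := by
        rw [map_mul, aeval_X, SimpleGraph.adjMatrix_mul_apply]
        refine Finset.sum_eq_zero fun z hz => hr0 (j + 1) (Nat.lt_succ_self j) hj z y ?_
        have h1 := hconn.dist_triangle (u := z) (v := x) (w := y)
        rw [SimpleGraph.dist_eq_one_iff_adj.2 ((G.mem_neighborFinset x z).1 hz).symm] at h1
        omega
      rw [hleft, Matrix.smul_apply, smul_eq_mul, eq_comm, mul_eq_zero] at hexp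
      exact hexp.resolve_left (div_ne_zero hcoef (scalar_orthoPoly_self_ne_zero G (by omega)))
    · intro l hl hlj
      rw [Matrix.smul_apply]
      rcases lt_or_gt_of_ne hlj with h | h
      · rw [hcoef0 l h, zero_div, zero_smul]
      · rw [hr0 l h (Nat.lt_succ_iff.1 (Finset.mem_range.1 hl)) x y (by omega), smul_zero]
    · intro h
      exact absurd (Finset.mem_range.2 (by omega)) h
  ext x y
  rw [distMatrix_apply]
  rcases lt_trichotomy (G.dist x y) j with h | h | h
  · rw [if_neg h.ne, predist_eq_smul, map_smul, Matrix.smul_apply, hrj x y h, smul_zero]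
  · rw [if_pos h, ← aeval_predistSum_apply hconn hreg x y, predistSum, map_sum, Matrix.sum_apply]
    refine Finset.sum_eq_single j (fun l hl hlj => ?_) fun h' =>
      absurd (Finset.mem_range.2 (by omega)) h'
    rcases lt_or_gt_of_ne hlj with hlt | hgt
    · refine aeval_adjMatrix_apply_eq_zero G ((degree_predist_le G l).trans_lt ?_)
      rw [h]
      exact_mod_cast hlt
    · rw [← ih l hgt (Nat.lt_succ_iff.1 (Finset.mem_range.1 hl)), distMatrix_apply,
        if_neg (by omega)]
  · rw [if_neg h.ne', aeval_adjMatrix_apply_eq_zero G ((degree_predist_le G j).trans_lt ?_)]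
    exact_mod_cast h

/-- If `A_d = p_d(A)`, then all the distance matrices are predistance polynomials in `A`. -/
lemma distMatrix_eq_aeval_predist (hconn : G.Connected) (hreg : G.IsRegularOfDegree k)
    (hex : ∀ l ≤ dNum G, ∃ u v : V, G.dist u v = l)
    (h : distMatrix G (dNum G) = aeval (G.adjMatrix ℝ) (predist G (dNum G))) {j : ℕ}
    (hj : j ≤ dNum G) : distMatrix G j = aeval (G.adjMatrix ℝ) (predist G j) := by
  obtain ⟨m, hm⟩ := Nat.exists_eq_add_of_le hj
  induction m using Nat.strong_induction_on generalizing j with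
  | _ m ih =>
    rcases m with _ | m
    · rw [show j = dNum G by omega, h]
    · exact distMatrix_eq_aeval_predist_step hconn hreg (by omega) hex fun l hjl hl =>
        ih (dNum G - l) (by omega) hl (by omega)

lemma isDistanceRegular_of_distMatrix_eq (hconn : G.Connected) (hreg : G.IsRegularOfDegree k)
    (hdiam : G.diam = dNum G)
    (h : distMatrix G (dNum G) = aeval (G.adjMatrix ℝ) (predist G (dNum G))) :
    IsDistanceRegular G := by
  have hex : ∀ l ≤ dNum G, ∃ u v : V, G.dist u v = l := by
    intro l hl
    obtain ⟨u, v, huv⟩ := G.exists_dist_eq_diam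
    exact ⟨u, exists_dist_eq hconn (x := u) (z := v) (by omega)⟩
  have hA := fun j hj => distMatrix_eq_aeval_predist hconn hreg hex h (j := j) hj
  -- the entries of a polynomial in `A` depend on the distance only
  have hpoly : ∀ (f : ℝ[X]) (x y x' y' : V), G.dist x y = G.dist x' y' →
      aeval (G.adjMatrix ℝ) f x y = aeval (G.adjMatrix ℝ) f x' y' := by
    intro f x y x' y' hd
    rw [aeval_eq_sum_orthoPoly, Matrix.sum_apply, Matrix.sum_apply]
    refine Finset.sum_congr rfl fun l hl => ?_
    have hl := Nat.lt_succ_iff.1 (Finset.mem_range.1 hl)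
    obtain ⟨u, v, huv⟩ := hex l hl
    obtain ⟨a, ha⟩ := smul_aeval_orthoPoly_of_distMatrix_eq huv (hA l hl)
    simp only [ha, Matrix.smul_apply, distMatrix_apply, hd]
  have hcount : ∀ (i : ℕ) (x y x' y' : V), G.dist x y = G.dist x' y' →
      (Finset.univ.filter fun z => G.Adj y z ∧ G.dist x z = i).card
        = (Finset.univ.filter fun z => G.Adj y' z ∧ G.dist x' z = i).card := by
    intro i x y x' y' hd
    by_cases hi : i ≤ dNum G
    · have hentry : ∀ x y : V,
          ((Finset.univ.filter fun z => G.Adj y z ∧ G.dist x z = i).card : ℝ)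
            = aeval (G.adjMatrix ℝ) (X * predist G i) y x := by
        intro x y
        rw [map_mul, aeval_X, ← hA i hi, SimpleGraph.adjMatrix_mul_apply]
        simp only [distMatrix_apply, Finset.sum_boole]
        congr 2
        ext z
        simp [G.dist_comm (u := x)]
      have := hpoly (X * predist G i) y x y' x'
        (by rw [G.dist_comm, hd, G.dist_comm])
      rw [← hentry, ← hentry] at this
      exact_mod_cast this
    · have hempty : ∀ x y : V,
          (Finset.univ.filter fun z => G.Adj y z ∧ G.dist x z = i) = ∅ := by
        intro x y
        refine Finset.filter_eq_empty_iff.2 fun z _ hz => hi ?_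
        rw [← hz.2]
        exact dist_le_dNum hconn hreg x z
      rw [hempty, hempty]
  obtain ⟨b, hb⟩ := exists_forall_eq_of_dist (G := G)
    (F := fun x y => (Finset.univ.filter fun z => G.Adj y z ∧ G.dist x z = G.dist x y + 1).card)
    (fun x y x' y' hd => by
      simp only [← hd]
      exact hcount _ x y x' y' hd)
  obtain ⟨c, hc⟩ := exists_forall_eq_of_dist (G := G)
    (F := fun x y => (Finset.univ.filter fun z => G.Adj y z ∧ G.dist x z + 1 = G.dist x y).card)
    (fun x y x' y' hd => by
      simp only [← hd]
      rcases hm : G.dist x y with _ | m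
      · simp
      · simp only [Nat.add_right_cancel_iff]
        exact hcount _ x y x' y' hd)
  exact ⟨hconn, b, c, fun x y => ⟨hc x y, hb x y⟩⟩

end FromExcess

/-! ### The distance matrices of a distance-regular graph -/

section ToExcess

variable {V : Type*} [Fintype V] [DecidableEq V] {G : SimpleGraph V} [DecidableRel G.Adj] {k : ℕ}
  [Nonempty V]

omit [Nonempty V] in
/-- The intersection numbers express `A_i A` through distance matrices of index at most `i + 1`. -/
lemma exists_distMatrix_mul_adjMatrix_eq (hdr : IsDistanceRegular G) (hreg : G.IsRegularOfDegree k)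
    (i : ℕ) : ∃ g : ℕ → ℝ, (i + 1 ≤ G.diam → g (i + 1) ≠ 0) ∧
      distMatrix G i * G.adjMatrix ℝ = ∑ j ∈ Finset.range (i + 2), g j • distMatrix G j := by
  obtain ⟨hconn, b, c, hbc⟩ := hdr
  have := hconn.nonempty
  refine ⟨fun j => if j = i + 1 then (c j : ℝ) else if j = i then k - b j - c j else
    if j + 1 = i then b j else 0, ?_, ?_⟩
  · intro hi
    obtain ⟨u, v, huv⟩ := G.exists_dist_eq_diam
    obtain ⟨z, hz⟩ := exists_dist_eq hconn (x := u) (z := v) (j := i + 1) (by omega)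
    obtain ⟨y, hadj, hy⟩ := exists_adj_dist_eq hconn hz
    have h := (hbc u z).1
    rw [hz] at h
    simp only [if_true, ← h]
    exact_mod_cast (Finset.card_pos.2 ⟨y, by simp [hadj, hy]⟩).ne'
  · ext x y
    have hentry : (distMatrix G i * G.adjMatrix ℝ) x y
        = ((G.neighborFinset y).filter fun z => G.dist x z = i).card := by
      rw [SimpleGraph.mul_adjMatrix_apply]
      simp [distMatrix_apply]
    have hnear : ∀ z ∈ G.neighborFinset y, G.dist x z + 1 = G.dist x y ∨
        G.dist x z = G.dist x y ∨ G.dist x z = G.dist x y + 1 := by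
      intro z hz
      have hyz : G.dist y z = 1 := SimpleGraph.dist_eq_one_iff_adj.2 ((G.mem_neighborFinset y z).1 hz)
      have h1 := hconn.dist_triangle (u := x) (v := y) (w := z)
      have h2 := hconn.dist_triangle (u := x) (v := z) (w := y)
      rw [G.dist_comm (u := z)] at h2
      omega
    have hc : ((G.neighborFinset y).filter fun z => G.dist x z + 1 = G.dist x y).card
        = c (G.dist x y) := by
      rw [← (hbc x y).1]
      congr 1
      ext z
      simp
    have hb : ((G.neighborFinset y).filter fun z => G.dist x z = G.dist x y + 1).card
        = b (G.dist x y) := by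
      rw [← (hbc x y).2]
      congr 1
      ext z
      simp
    have ha : ((G.neighborFinset y).filter fun z => G.dist x z = G.dist x y).card
        + c (G.dist x y) + b (G.dist x y) = k := by
      rw [← hreg y, ← G.card_neighborFinset_eq_degree, ← hb, ← hc,
        ← Finset.card_union_of_disjoint, ← Finset.card_union_of_disjoint]
      · congr 1
        ext z
        simp only [Finset.mem_union, Finset.mem_filter]
        have := hnear z
        tauto
      · rw [Finset.disjoint_left]
        intro z hz hz'
        simp only [Finset.mem_union, Finset.mem_filter] at hz hz'
        omega
      · rw [Finset.disjoint_left]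
        intro z hz hz'
        simp only [Finset.mem_filter] at hz hz'
        omega
    rw [hentry, Matrix.sum_apply]
    simp only [Matrix.smul_apply, distMatrix_apply, smul_eq_mul, mul_ite, mul_one, mul_zero]
    rw [Finset.sum_ite_eq]
    by_cases h1 : G.dist x y = i + 1
    · rw [if_pos (by simp [h1]), if_pos h1, ← hc]
      simp [h1]
    · rw [if_neg h1]
      by_cases h2 : G.dist x y = i
      · rw [if_pos (by simp [h2]), if_pos h2, ← ha]
        simp only [h2]
        push_cast
        ring
      · rw [if_neg h2]
        by_cases h3 : G.dist x y + 1 = i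
        · rw [if_pos (by rw [Finset.mem_range]; omega), if_pos h3, ← hb, h3]
        · rw [if_neg h3, ite_self, Nat.cast_eq_zero, Finset.card_eq_zero]
          refine Finset.filter_eq_empty_iff.2 fun z hz hzi => ?_
          have := hnear z hz
          omega

omit [Nonempty V] in
lemma exists_aeval_eq_distMatrix (hdr : IsDistanceRegular G) (hreg : G.IsRegularOfDegree k) {i : ℕ}
    (hi : i ≤ G.diam) :
    distMatrix G i ∈ (degreeLT ℝ (i + 1)).map (aeval (G.adjMatrix ℝ)).toLinearMap := by
  induction i using Nat.strong_induction_on with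
  | _ i ih =>
    rcases i with _ | i
    · refine ⟨1, ?_, ?_⟩
      · rw [SetLike.mem_coe, mem_degreeLT, degree_one]
        exact_mod_cast Nat.zero_lt_one
      · ext x y
        simp [distMatrix_apply, Matrix.one_apply, hdr.1.dist_eq_zero_iff]
    · obtain ⟨g, hg, hmul⟩ := exists_distMatrix_mul_adjMatrix_eq hdr hreg i
      obtain ⟨f, hf, hfA⟩ := ih i (Nat.lt_succ_self i) (by omega)
      have hmem : distMatrix G i * G.adjMatrix ℝ ∈
          (degreeLT ℝ (i + 1 + 1)).map (aeval (G.adjMatrix ℝ)).toLinearMap := by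
        refine ⟨f * X, ?_, ?_⟩
        · rw [SetLike.mem_coe, mem_degreeLT] at hf ⊢
          rw [degree_mul_X]
          push_cast at hf ⊢
          exact WithBot.add_lt_add_right (by simp) hf
        · rw [← hfA]
          simp
      have hsum : ∑ j ∈ Finset.range (i + 1), g j • distMatrix G j ∈
          (degreeLT ℝ (i + 1 + 1)).map (aeval (G.adjMatrix ℝ)).toLinearMap := by
        refine Submodule.sum_mem _ fun j hj => Submodule.smul_mem _ _ ?_
        have hj := Finset.mem_range.1 hj
        exact Submodule.map_mono (degreeLT_mono (by omega)) (ih j hj (by omega))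
      rw [Finset.sum_range_succ] at hmul
      have : distMatrix G (i + 1) = (g (i + 1))⁻¹ • (distMatrix G i * G.adjMatrix ℝ
          - ∑ j ∈ Finset.range (i + 1), g j • distMatrix G j) := by
        rw [hmul, add_sub_cancel_left, smul_smul, inv_mul_cancel₀ (hg hi), one_smul]
      rw [this]
      exact Submodule.smul_mem _ _ (Submodule.sub_mem _ hmem hsum)

lemma diam_le_dNum (hconn : G.Connected) (hreg : G.IsRegularOfDegree k) : G.diam ≤ dNum G := by
  obtain ⟨u, v, huv⟩ := G.exists_dist_eq_diam
  rw [← huv]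
  exact dist_le_dNum hconn hreg u v

omit [DecidableEq V] [DecidableRel G.Adj] in
lemma dist_le_diam_of_connected (hconn : G.Connected) (x y : V) : G.dist x y ≤ G.diam :=
  G.dist_le_diam (SimpleGraph.connected_iff_ediam_ne_top.1 hconn)

/-- The span of `A_0, …, A_D` contains all powers of `A`, so `A` satisfies a polynomial equation of
degree `D + 1`. -/
lemma diam_eq_dNum (hdr : IsDistanceRegular G) (hreg : G.IsRegularOfDegree k) :
    G.diam = dNum G := by
  refine le_antisymm (diam_le_dNum hdr.1 hreg) ?_
  by_contra! hlt
  set S := Submodule.span ℝ (distMatrix G '' {j | j ≤ G.diam}) with hS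
  have hdist : ∀ j, distMatrix G j ∈ S := by
    intro j
    by_cases hj : j ≤ G.diam
    · exact Submodule.subset_span ⟨j, hj, rfl⟩
    · have : distMatrix G j = 0 := by
        ext x y
        have := dist_le_diam_of_connected hdr.1 x y
        rw [distMatrix_apply, if_neg (by omega), Matrix.zero_apply]
      rw [this]
      exact S.zero_mem
  have hmul : ∀ M ∈ S, M * G.adjMatrix ℝ ∈ S := by
    intro M hM
    induction hM using Submodule.span_induction with
    | mem M hM =>
      obtain ⟨j, -, rfl⟩ := hM
      obtain ⟨g, -, hg⟩ := exists_distMatrix_mul_adjMatrix_eq hdr hreg j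
      rw [hg]
      exact Submodule.sum_mem _ fun l _ => S.smul_mem _ (hdist l)
    | zero => simp
    | add M N _ _ hM hN => rw [add_mul]; exact S.add_mem hM hN
    | smul a M _ hM => rw [smul_mul_assoc]; exact S.smul_mem a hM
  have hpow : ∀ m, G.adjMatrix ℝ ^ m ∈ S := by
    intro m
    induction m with
    | zero =>
      have h0 : distMatrix G 0 = 1 := by
        ext x y
        simp [distMatrix_apply, Matrix.one_apply, hdr.1.dist_eq_zero_iff]
      rw [pow_zero, ← h0]
      exact hdist 0
    | succ m ih => rw [pow_succ]; exact hmul _ ih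
  have hle : S ≤ (degreeLT ℝ (G.diam + 1)).map (aeval (G.adjMatrix ℝ)).toLinearMap := by
    rw [hS, Submodule.span_le]
    rintro _ ⟨j, hj, rfl⟩
    have hj : j ≤ G.diam := hj
    exact Submodule.map_mono (degreeLT_mono (by omega)) (exists_aeval_eq_distMatrix hdr hreg hj)
  obtain ⟨f, hf, hfA⟩ := hle (hpow (G.diam + 1))
  rw [SetLike.mem_coe, mem_degreeLT] at hf
  have hne : (X ^ (G.diam + 1) - f).Monic := monic_X_pow_sub hf
  refine hne.ne_zero (eq_zero_of_eval_eigs G ?_ fun θ hθ => eval_eq_zero_of_aeval G ?_ hθ)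
  · rw [degree_sub_eq_left_of_degree_lt (by rwa [degree_X_pow]), degree_X_pow]
    exact_mod_cast Nat.succ_lt_succ hlt
  · have hfA : aeval (G.adjMatrix ℝ) f = G.adjMatrix ℝ ^ (G.diam + 1) := hfA
    rw [map_sub, hfA]
    simp

/-- `p_d(A) - A_d` is a polynomial of degree less than `d` in `A`, hence orthogonal to both terms. -/
lemma distMatrix_eq_of_isDistanceRegular (hdr : IsDistanceRegular G)
    (hreg : G.IsRegularOfDegree k) :
    distMatrix G (dNum G) = aeval (G.adjMatrix ℝ) (predist G (dNum G)) := by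
  have hdiam := diam_eq_dNum hdr hreg
  have hconn := hdr.1
  have hmem : ∑ j ∈ Finset.range (dNum G), distMatrix G j ∈
      (degreeLT ℝ (dNum G)).map (aeval (G.adjMatrix ℝ)).toLinearMap := by
    refine Submodule.sum_mem _ fun j hj => ?_
    have hj := Finset.mem_range.1 hj
    exact Submodule.map_mono (degreeLT_mono (by omega))
      (exists_aeval_eq_distMatrix hdr hreg (by omega))
  obtain ⟨g, hg, hgA⟩ := hmem
  rw [SetLike.mem_coe, mem_degreeLT] at hg
  have hgA : aeval (G.adjMatrix ℝ) g = ∑ j ∈ Finset.range (dNum G), distMatrix G j := hgA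
  have hu : (g - predistSum G (dNum G)).degree < dNum G :=
    (degree_sub_le _ _).trans_lt (max_lt hg (degree_predistSum_lt G _))
  have huA : aeval (G.adjMatrix ℝ) (g - predistSum G (dNum G))
      = aeval (G.adjMatrix ℝ) (predist G (dNum G)) - distMatrix G (dNum G) := by
    have hJ : ∑ j ∈ Finset.range (dNum G + 1), distMatrix G j
        = aeval (G.adjMatrix ℝ) (predistSum G (dNum G + 1)) := by
      ext x y
      have := dist_le_dNum hconn hreg x y
      rw [aeval_predistSum_apply hconn hreg, Matrix.sum_apply]
      simp only [distMatrix_apply]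
      rw [Finset.sum_ite_eq, if_pos (Finset.mem_range.2 (by omega))]
    rw [Finset.sum_range_succ, predistSum_succ, map_add, ← hgA] at hJ
    rw [map_sub, sub_eq_sub_iff_add_eq_add, hJ, add_comm]
  set u := g - predistSum G (dNum G) with hudef
  have hup : scalar G u (predist G (dNum G)) = 0 := by
    rw [scalar_comm, predist_eq_smul, scalar_smul_left, scalar_orthoPoly_of_degree_lt G hu, mul_zero]
  have huu : scalar G u u = 0 := by
    rw [← hup, scalar_eq_sum_entries, scalar_eq_sum_entries]
    congr 1
    refine Finset.sum_congr rfl fun x _ => Finset.sum_congr rfl fun y _ => ?_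
    by_cases hxy : G.dist x y = dNum G
    · rw [aeval_adjMatrix_apply_eq_zero G (hxy ▸ hu), zero_mul, zero_mul]
    · conv_lhs => rw [huA]
      rw [Matrix.sub_apply, distMatrix_apply, if_neg hxy, sub_zero, huA, Matrix.sub_apply,
        distMatrix_apply, if_neg hxy, sub_zero]
  have h0 := aeval_eq_zero_of_scalar_self G huu
  rw [huA, sub_eq_zero] at h0
  exact h0.symm

end ToExcess

/-! ### Characterizations of distance-regularity -/

section Equivalences

variable {V : Type*} [Fintype V] [DecidableEq V] {G : SimpleGraph V} [DecidableRel G.Adj] {k : ℕ}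
  [Nonempty V]

lemma isDistanceRegular_iff_distMatrix_eq (hconn : G.Connected) (hreg : G.IsRegularOfDegree k) :
    IsDistanceRegular G ↔ G.diam = dNum G ∧
      distMatrix G (dNum G) = aeval (G.adjMatrix ℝ) (predist G (dNum G)) :=
  ⟨fun h => ⟨diam_eq_dNum h hreg, distMatrix_eq_of_isDistanceRegular h hreg⟩,
    fun h => isDistanceRegular_of_distMatrix_eq hconn hreg h.1 h.2⟩

lemma isDistanceRegular_iff_mean_card_sphere (hconn : G.Connected) (hreg : G.IsRegularOfDegree k) :
    IsDistanceRegular G ↔ G.diam = dNum G ∧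
      (1 / (Fintype.card V : ℝ)) * ∑ x, ((sphere G (dNum G) x).card : ℝ)
        = (predist G (dNum G)).eval (k : ℝ) := by
  have h := mean_card_sphere_eq_iff hconn hreg (D := dNum G) le_rfl
  rw [Finset.Icc_self, Finset.sum_singleton, Finset.sum_singleton] at h
  rw [isDistanceRegular_iff_distMatrix_eq hconn hreg, h]

/-- If `A_d = p_d(A)`, all the numbers `|X| - |Γ_d(x)|` are equal to `q_{d-1}(k)`. -/
lemma harmMean_eq_of_distMatrix_eq (hconn : G.Connected) (hreg : G.IsRegularOfDegree k)
    (h : distMatrix G (dNum G) = aeval (G.adjMatrix ℝ) (predist G (dNum G))) :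
    harmMean G (dNum G) = (predistSum G (dNum G)).eval (k : ℝ) := by
  have hsum := predistSum_eval_degree hconn hreg
  rw [predistSum_succ, eval_add] at hsum
  have hcard : ∀ x, (Fintype.card V : ℝ) - ((sphere G (dNum G) x).card : ℝ)
      = (predistSum G (dNum G)).eval (k : ℝ) := fun x => by
    rw [← sum_distMatrix_apply, h, sum_aeval_adjMatrix_apply hreg, ← hsum, add_sub_cancel_right]
  have hn := (card_pos_real (V := V)).ne'
  simp only [harmMean, hcard, Finset.sum_const, Finset.card_univ, nsmul_eq_mul]
  -- if `d = 0`, then `q_{d-1}(k) = 0`, and the quotient is `0` by the convention for `1 / 0`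
  rcases eq_or_ne ((predistSum G (dNum G)).eval (k : ℝ)) 0 with h0 | h0
  · simp [h0]
  · field_simp

lemma isDistanceRegular_iff_harmMean (hconn : G.Connected) (hreg : G.IsRegularOfDegree k) :
    IsDistanceRegular G ↔ G.diam = dNum G ∧
      harmMean G (dNum G) = (predistSum G (dNum G)).eval (k : ℝ) := by
  rw [isDistanceRegular_iff_distMatrix_eq hconn hreg]
  exact and_congr_right fun _ => ⟨harmMean_eq_of_distMatrix_eq hconn hreg,
    distMatrix_eq_of_harmMean_eq hconn hreg⟩

end Equivalences

/-! ### Polynomials in a matrix and spans of powers -/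

section Span

variable {V : Type*} [Fintype V] [DecidableEq V]

lemma exists_aeval_eq_of_mem_span_pow {A M : Matrix V V ℝ} {d : ℕ}
    (hM : M ∈ Submodule.span ℝ {M | ∃ i : ℕ, i ≤ d ∧ M = A ^ i}) : ∃ f : ℝ[X], aeval A f = M := by
  have hle : Submodule.span ℝ {M | ∃ i : ℕ, i ≤ d ∧ M = A ^ i}
      ≤ LinearMap.range (aeval A : ℝ[X] →ₐ[ℝ] Matrix V V ℝ).toLinearMap := by
    rw [Submodule.span_le]
    rintro _ ⟨i, -, rfl⟩
    exact ⟨X ^ i, by simp⟩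
  exact hle hM

lemma aeval_mem_span_pow {A : Matrix V V ℝ} {d : ℕ} {f : ℝ[X]}
    (hf : f.degree ≤ d) : aeval A f ∈ Submodule.span ℝ {M | ∃ i : ℕ, i ≤ d ∧ M = A ^ i} := by
  rw [aeval_eq_sum_range]
  refine Submodule.sum_mem _ fun i hi => Submodule.smul_mem _ _ (Submodule.subset_span ⟨i, ?_, rfl⟩)
  exact (Nat.lt_succ_iff.1 (Finset.mem_range.1 hi)).trans (natDegree_le_of_degree_le hf)

end Span

end GraphSpectrum

open GraphSpectrum in
theorem corollary2p2 {V : Type*} [Fintype V] [DecidableEq V] (G : SimpleGraph V)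
    [DecidableRel G.Adj] (hconn : G.Connected) (k : ℕ) (hreg : G.IsRegularOfDegree k)
    (n : ℝ) (hn : n = (Fintype.card V : ℝ)) (D d : ℕ) (hD : D = G.diam) (hd : d = dNum G) :
    -- the largest eigenvalue is the degree
    lambda0 G = k ∧
    -- (i)
    (n - ∑ i ∈ Finset.Icc D d, (predist G i).eval (k : ℝ) ≤ arithMean G D ∧
      (arithMean G D = n - ∑ i ∈ Finset.Icc D d, (predist G i).eval (k : ℝ) ↔
        distMatrix G D = ∑ i ∈ Finset.Icc D d, aeval (G.adjMatrix ℝ) (predist G i))) ∧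
    -- (ii)
    (distMatrix G D ∈ Submodule.span ℝ {M | ∃ i : ℕ, i ≤ d ∧ M = G.adjMatrix ℝ ^ i} →
      ∀ x : V, ((sphere G D x).card : ℝ) ≤ ∑ i ∈ Finset.Icc D d, (predist G i).eval (k : ℝ)) ∧
    -- (iii)
    (arithMean G D = n - ∑ i ∈ Finset.Icc D d, (predist G i).eval (k : ℝ) →
      distMatrix G D ∈ Submodule.span ℝ {M | ∃ i : ℕ, i ≤ d ∧ M = G.adjMatrix ℝ ^ i}) ∧
    -- the two evaluations that hold for every such graph
    (∑ i ∈ Finset.range d, (predist G i).eval (k : ℝ) = n - (predist G d).eval (k : ℝ) ∧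
      (predist G d).eval (k : ℝ) = n * (phiSum G)⁻¹) ∧
    -- (iv), with the harmonic mean
    (IsDistanceRegular G ↔ D = d ∧
      harmMean G d = ∑ i ∈ Finset.range d, (predist G i).eval (k : ℝ) ∧
      ∑ i ∈ Finset.range d, (predist G i).eval (k : ℝ) = n - (predist G d).eval (k : ℝ) ∧
      n - (predist G d).eval (k : ℝ) = n * (1 - (phiSum G)⁻¹)) ∧
    -- (iv), with the arithmetic mean
    (IsDistanceRegular G ↔ D = d ∧
      arithMean G D = n - (predist G d).eval (k : ℝ) ∧
      n - (predist G d).eval (k : ℝ) = n * (1 - (phiSum G)⁻¹)) ∧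
    -- (iv), with the mean of the numbers of vertices at distance `D`
    (IsDistanceRegular G ↔ D = d ∧
      (1 / n) * ∑ x : V, ((sphere G D x).card : ℝ) = (predist G d).eval (k : ℝ) ∧
      (predist G d).eval (k : ℝ) = n * (phiSum G)⁻¹) := by
  subst hn hD hd
  have := hconn.nonempty
  have hDd := diam_le_dNum hconn hreg
  have hl := lambda0_eq_degree hreg
  have hk := degree_mem_eigs hreg
  have hHk := predistSum_eval_degree hconn hreg
  rw [predistSum_succ, eval_add] at hHk
  have hq : ∑ i ∈ Finset.range (dNum G), (predist G i).eval (k : ℝ)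
      = (Fintype.card V : ℝ) - (predist G (dNum G)).eval (k : ℝ) := by
    rw [← eval_predistSum, ← hHk, add_sub_cancel_right]
  have hp : (predist G (dNum G)).eval (k : ℝ) = (Fintype.card V : ℝ) * (phiSum G)⁻¹ := by
    have := predist_dNum_eval_lambda0 G (hl ▸ hk) (hl ▸ mult_degree hconn hreg)
    rwa [hl] at this
  have hnp : (Fintype.card V : ℝ) - (predist G (dNum G)).eval (k : ℝ)
      = (Fintype.card V : ℝ) * (1 - (phiSum G)⁻¹) := by
    rw [hp]; ring
  have hle := mean_card_sphere_le hconn hreg hDd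
  have hiff := mean_card_sphere_eq_iff hconn hreg hDd
  have harith : arithMean G G.diam = (Fintype.card V : ℝ)
        - ∑ i ∈ Finset.Icc G.diam (dNum G), (predist G i).eval (k : ℝ) ↔
      distMatrix G G.diam
        = ∑ i ∈ Finset.Icc G.diam (dNum G), aeval (G.adjMatrix ℝ) (predist G i) := by
    rw [← hiff, arithMean_eq, sub_right_inj]
  refine ⟨hl, ⟨?_, harith⟩, ?_, ?_, ⟨hq, hp⟩, ?_, ?_, ?_⟩
  · rw [arithMean_eq]
    linarith
  · intro hspan x
    obtain ⟨f, hf⟩ := exists_aeval_eq_of_mem_span_pow hspan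
    exact card_sphere_le_of_aeval_eq hconn hreg hDd hf x
  · intro h
    rw [harith.1 h]
    refine Submodule.sum_mem _ fun i hi => aeval_mem_span_pow ((degree_predist_le G i).trans ?_)
    exact_mod_cast (Finset.mem_Icc.1 hi).2
  · rw [isDistanceRegular_iff_harmMean hconn hreg, eval_predistSum]
    exact and_congr_right fun _ => ⟨fun h => ⟨h, hq, hnp⟩, fun h => h.1⟩
  · rw [isDistanceRegular_iff_mean_card_sphere hconn hreg]
    refine and_congr_right fun hD => ?_
    rw [arithMean_eq, hD, sub_right_inj]
    exact ⟨fun h => ⟨h, hnp⟩, fun h => h.1⟩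
  · rw [isDistanceRegular_iff_mean_card_sphere hconn hreg]
    refine and_congr_right fun hD => ?_
    rw [hD]
    exact ⟨fun h => ⟨h, hp⟩, fun h => h.1⟩
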